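/- Let $(\Omega,\mathcal H,\hat E)$ be a sublinear expectation space: $\mathcal H$ is a linear space of real functions on $\Omega$ that contains the constants, is closed under $X\mapsto|X|$ and under $(X_1,\dots,X_n)\mapsto\varphi(X_1,\dots,X_n)$ for $\varphi\in C_{l,Lip}(\mathbb R^n)$ (the functions with $|\varphi(x)-\varphi(y)|\le C(1+|x|^m+|y|^m)|x-y|$ for some $C>0$, $m\in\mathbb N$), and $\hat E:\mathcal H\to\mathbb R$ is monotone, constant preserving, sub-additive and positively homogeneous. Let $Y_1,Y_2,\dots$ be $\mathbb R^d$-valued random vectors (all coordinates in $\mathcal H$) such that (i) for each $i\ge 1$, $Y_{i+1}$ is independent from $(Y_1,\dots,Y_i)$, i.e. with $Z=(Y_1,\dots,Y_i)$, $\hat E[\varphi(Z,Y_{i+1})]=\hat E\big[\hat E[\varphi(z,Y_{i+1})]|_{z=Z}\big]$ for all $\varphi\in C_{l,Lip}(\mathbb R^{id+d})$; (ii) there is a constant $M>0$ with $\hat E[|Y_i|^2]\le M$ for all $i$. For each $i$ let $\Gamma_i\subset\mathbb R^d$ be a bounded, convex and closed set with $g_i(p):=\hat E[\langle Y_i,p\rangle]=\sup_{q\in\Gamma_i}\langle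 q,p\rangle$ for all $p\in\mathbb R^d$ (in particular $\Gamma_i\neq\emptyset$), and suppose that $\{\Gamma_i\}$ is a Cauchy sequence for the Hausdorff distance $d_H$. Then there exists a nonempty bounded, convex and closed set $\Gamma\subset\mathbb R^d$ such that $d_H(\Gamma,\Gamma_i)\to0$ as $i\to\infty$ and, with $S_n=Y_1+\cdots+Y_n$, the sequence $S_n/n$ converges in law to the maximal distribution $N(\Gamma;0)$ over $\Gamma$. That is, there is a random vector $\eta$ on some sublinear expectation space $(\Omega',\mathcal H',\hat E')$ with $\hat E'[\varphi(\eta)]=\max_{y\in\Gamma}\varphi(y)$ for all bounded Lipschitz $\varphi:\mathbb R^d\to\mathbb R$, and $$\lim_{n\to\infty}\hat E\Big[\varphi\Big(\frac{S_n}{n}\Big)\Big]=\hat E'[\varphi(\eta)]=\max_{y\in\Gamma}\varphi(y)\qquad\text{for all bounded Lipschitz }\varphi:\mathbb R^d\to\mathbb R.$$ -/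

import Mathlib

open Filter Topology
open scoped NNReal

/-- The class `C_{l,Lip}(V)`: `|φ x - φ y| ≤ C (1 + |x|^m + |y|^m) |x - y|` for some `C > 0` and
`m ∈ ℕ`. It is only used for finite-dimensional `V` (that is `V = ℝⁿ`, possibly grouped into
blocks), where all norms are equivalent and hence define the same class. -/
def IsCLLip {V : Type*} [NormedAddCommGroup V] (φ : V → ℝ) : Prop :=
  ∃ C : ℝ, 0 < C ∧ ∃ m : ℕ, ∀ x y : V,
    |φ x - φ y| ≤ C * (1 + ‖x‖ ^ m + ‖y‖ ^ m) * ‖x - y‖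

/-- The class `C_{b,Lip}(V)` of bounded Lipschitz functions. -/
def IsCbLip {V : Type*} [NormedAddCommGroup V] (φ : V → ℝ) : Prop :=
  (∃ B : ℝ, ∀ x, |φ x| ≤ B) ∧ ∃ K : ℝ≥0, LipschitzWith K φ

/-- A sublinear expectation space `(Ω, H, E)`. The functional is written as a total function on
`Ω → ℝ`, but only its values on `H` carry any law, and only those values are ever used. -/
structure SublinearExpSpace (Ω : Type*) where
  /-- the linear space of random variables -/
  H : Submodule ℝ (Ω → ℝ)
  const_mem : ∀ c : ℝ, (fun _ => c) ∈ H
  abs_mem : ∀ X ∈ H, (fun ω => |X ω|) ∈ H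
  comp_mem : ∀ (n : ℕ) (X : Fin n → Ω → ℝ), (∀ i, X i ∈ H) →
    ∀ φ : (Fin n → ℝ) → ℝ, IsCLLip φ → (fun ω => φ (fun i => X i ω)) ∈ H
  /-- the sublinear expectation -/
  E : (Ω → ℝ) → ℝ
  mono : ∀ X ∈ H, ∀ Y ∈ H, (∀ ω, Y ω ≤ X ω) → E Y ≤ E X
  const_preserving : ∀ c : ℝ, E (fun _ => c) = c
  sub_additive : ∀ X ∈ H, ∀ Y ∈ H, E (fun ω => X ω + Y ω) ≤ E X + E Y
  pos_homogeneous : ∀ X ∈ H, ∀ c : ℝ, 0 ≤ c → E (fun ω => c * X ω) = c * E X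

namespace SublinearExpSpace

variable {Ω : Type*} (𝓔 : SublinearExpSpace Ω)

/-- `X` is a random vector of the space: all its (linear) coordinates belong to `H`.
See `isRandomVector_iff` for `ℝ^d`. -/
def IsRandomVector {V : Type*} [NormedAddCommGroup V] [NormedSpace ℝ V] (X : Ω → V) : Prop :=
  ∀ l : V →L[ℝ] ℝ, (fun ω => l (X ω)) ∈ 𝓔.H

/-- `Y` is independent from `X`: for every `φ ∈ C_{l,Lip}`,
`E[φ(X, Y)] = E[ E[φ(x, Y)]|_{x = X} ]`. -/
def IndepFrom {V W : Type*} [NormedAddCommGroup V] [NormedAddCommGroup W]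
    (Y : Ω → W) (X : Ω → V) : Prop :=
  ∀ φ : V × W → ℝ, IsCLLip φ →
    𝓔.E (fun ω => φ (X ω, Y ω)) = 𝓔.E (fun ω => 𝓔.E (fun ω' => φ (X ω, Y ω')))

/-- `η` is maximal distributed over `Γ`, written `η ∼ N(Γ; 0)`. -/
def IsMaximalDistributed {d : ℕ} (η : Ω → EuclideanSpace ℝ (Fin d))
    (Γ : Set (EuclideanSpace ℝ (Fin d))) : Prop :=
  𝓔.IsRandomVector η ∧ Bornology.IsBounded Γ ∧ Convex ℝ Γ ∧ IsClosed Γ ∧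
    ∀ φ : EuclideanSpace ℝ (Fin d) → ℝ, IsCbLip φ →
      IsGreatest (φ '' Γ) (𝓔.E (fun ω => φ (η ω)))

/-- `Z n` (on `Ω`) converges in law to `η` (on a possibly different space `Ω'`). -/
def ConvergesInLaw {Ω' : Type*} {d : ℕ} (Z : ℕ → Ω → EuclideanSpace ℝ (Fin d))
    (𝓔' : SublinearExpSpace Ω') (η : Ω' → EuclideanSpace ℝ (Fin d)) : Prop :=
  ∀ φ : EuclideanSpace ℝ (Fin d) → ℝ, IsCbLip φ →
    Tendsto (fun n => 𝓔.E (fun ω => φ (Z n ω))) atTop (𝓝 (𝓔'.E (fun ω => φ (η ω))))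

end SublinearExpSpace

/-! Facts showing that the functional is only evaluated on `H` in the definitions above. -/

theorem IsCLLip.comp_clm {U V : Type*} [NormedAddCommGroup U] [NormedSpace ℝ U]
    [NormedAddCommGroup V] [NormedSpace ℝ V] {φ : V → ℝ} (hφ : IsCLLip φ) (f : U →L[ℝ] V) :
    IsCLLip (fun x => φ (f x)) := by
  obtain ⟨C, hC, m, h⟩ := hφ
  set K : ℝ := 1 + ‖f‖ with hK
  have hK1 : 1 ≤ K := by simp [hK]
  have hb : ∀ x, ‖f x‖ ≤ K * ‖x‖ := fun x => (f.le_opNorm x).trans (by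
    gcongr; simp [hK])
  have hKm : 1 ≤ K ^ m := one_le_pow₀ hK1
  refine ⟨C * K ^ m * K, by positivity, m, fun x y => (h _ _).trans ?_⟩
  have h1 : ‖f x‖ ^ m ≤ K ^ m * ‖x‖ ^ m := by
    rw [← mul_pow]; exact pow_le_pow_left₀ (norm_nonneg _) (hb x) m
  have h2 : ‖f y‖ ^ m ≤ K ^ m * ‖y‖ ^ m := by
    rw [← mul_pow]; exact pow_le_pow_left₀ (norm_nonneg _) (hb y) m
  have h3 : ‖f x - f y‖ ≤ K * ‖x - y‖ := by rw [← map_sub]; exact hb _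
  calc C * (1 + ‖f x‖ ^ m + ‖f y‖ ^ m) * ‖f x - f y‖
      ≤ C * (K ^ m * 1 + K ^ m * ‖x‖ ^ m + K ^ m * ‖y‖ ^ m) * (K * ‖x - y‖) := by
        gcongr; simpa using hKm
    _ = C * K ^ m * K * (1 + ‖x‖ ^ m + ‖y‖ ^ m) * ‖x - y‖ := by ring

theorem isCLLip_norm_pow {V : Type*} [NormedAddCommGroup V] (m : ℕ) :
    IsCLLip (fun x : V => ‖x‖ ^ m) := by
  refine ⟨m + 1, by positivity, m - 1, fun x y => ?_⟩
  refine (abs_pow_sub_pow_le ‖x‖ ‖y‖ m).trans ?_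
  rw [abs_norm, abs_norm]
  have h1 : |‖x‖ - ‖y‖| ≤ ‖x - y‖ := abs_norm_sub_norm_le x y
  have h2 : max ‖x‖ ‖y‖ ^ (m - 1) ≤ 1 + ‖x‖ ^ (m - 1) + ‖y‖ ^ (m - 1) := by
    have hx : 0 ≤ ‖x‖ ^ (m - 1) := by positivity
    have hy : 0 ≤ ‖y‖ ^ (m - 1) := by positivity
    rcases max_choice ‖x‖ ‖y‖ with h | h <;> rw [h] <;> linarith
  calc |‖x‖ - ‖y‖| * m * max ‖x‖ ‖y‖ ^ (m - 1)
      ≤ ‖x - y‖ * (m + 1) * (1 + ‖x‖ ^ (m - 1) + ‖y‖ ^ (m - 1)) := by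
        gcongr; linarith
    _ = _ := by ring

theorem IsCbLip.isCLLip {V : Type*} [NormedAddCommGroup V] {φ : V → ℝ} (h : IsCbLip φ) :
    IsCLLip φ := by
  obtain ⟨-, K, hK⟩ := h
  refine ⟨K + 1, by positivity, 0, fun x y => ?_⟩
  have := hK.dist_le_mul x y
  rw [Real.dist_eq, dist_eq_norm] at this
  simp only [pow_zero]
  nlinarith [norm_nonneg (x - y), K.coe_nonneg]

theorem IsCLLip.prod_right {V W : Type*} [NormedAddCommGroup V] [NormedAddCommGroup W]
    {φ : V × W → ℝ} (hφ : IsCLLip φ) (x : V) : IsCLLip (fun y => φ (x, y)) := by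
  obtain ⟨C, hC, m, h⟩ := hφ
  have hn : ∀ y : W, ‖(x, y)‖ ^ m ≤ ‖x‖ ^ m + ‖y‖ ^ m := by
    intro y
    have hx : 0 ≤ ‖x‖ ^ m := by positivity
    have hy : 0 ≤ ‖y‖ ^ m := by positivity
    rw [Prod.norm_def]
    rcases max_choice ‖x‖ ‖y‖ with h | h <;> simp only [h] <;> linarith
  refine ⟨C * (1 + 2 * ‖x‖ ^ m), by positivity, m, fun y z => (h _ _).trans ?_⟩
  have e : ‖(x, y) - (x, z)‖ = ‖y - z‖ := by simp [Prod.norm_def]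
  have hx : 0 ≤ ‖x‖ ^ m := by positivity
  have hy : 0 ≤ ‖y‖ ^ m := by positivity
  have hz : 0 ≤ ‖z‖ ^ m := by positivity
  rw [e, mul_assoc C (1 + 2 * ‖x‖ ^ m)]
  gcongr
  nlinarith [hn y, hn z, mul_nonneg hx hy, mul_nonneg hx hz]

namespace SublinearExpSpace

variable {Ω : Type*} (𝓔 : SublinearExpSpace Ω)

theorem isRandomVector_iff {d : ℕ} (X : Ω → EuclideanSpace ℝ (Fin d)) :
    𝓔.IsRandomVector X ↔ ∀ k, (fun ω => X ω k) ∈ 𝓔.H := by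
  constructor
  · intro h k
    exact h (EuclideanSpace.proj k)
  · intro h l
    have : (fun ω => l (X ω)) = ∑ k, l (EuclideanSpace.single k 1) • (fun ω => X ω k) := by
      funext ω
      have hx : X ω = ∑ k, X ω k • EuclideanSpace.single k (1 : ℝ) := by
        ext j
        simp [Finset.sum_apply, Pi.single_apply]
      conv_lhs => rw [hx]
      simp [map_sum, mul_comm]
    rw [this]
    exact Submodule.sum_mem _ fun k _ => Submodule.smul_mem _ _ (h k)

/-- `C_{l,Lip}` functions of random vectors belong to `H`. -/
theorem IsRandomVector.comp_mem {V : Type*} [NormedAddCommGroup V] [NormedSpace ℝ V]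
    [FiniteDimensional ℝ V] {X : Ω → V} (hX : 𝓔.IsRandomVector X) {φ : V → ℝ}
    (hφ : IsCLLip φ) : (fun ω => φ (X ω)) ∈ 𝓔.H := by
  let e := (Module.finBasis ℝ V).equivFunL
  have h := 𝓔.comp_mem _ (fun i ω => e (X ω) i)
    (fun i => hX ((ContinuousLinearMap.proj (R := ℝ) (φ := fun _ => ℝ) i).comp
      (e : V →L[ℝ] (Fin (Module.finrank ℝ V) → ℝ))))
    (fun z => φ (e.symm z)) (hφ.comp_clm (e.symm : (Fin (Module.finrank ℝ V) → ℝ) →L[ℝ] V))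
  have h2 : (fun ω => φ (e.symm (fun i => e (X ω) i))) = fun ω => φ (X ω) := by
    funext ω
    exact congrArg φ (e.symm_apply_apply (X ω))
  exact h2 ▸ h

/-- The function `x ↦ E[φ(x, Y)]` in the definition of independence is again in `C_{l,Lip}`. -/
theorem IsRandomVector.isCLLip_partial {V W : Type*} [NormedAddCommGroup V]
    [NormedAddCommGroup W] [NormedSpace ℝ W] [FiniteDimensional ℝ W] {Y : Ω → W}
    (hY : 𝓔.IsRandomVector Y) {φ : V × W → ℝ} (hφ : IsCLLip φ) :
    IsCLLip (fun x => 𝓔.E (fun ω => φ (x, Y ω))) := by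
  have hF : ∀ x, (fun ω => φ (x, Y ω)) ∈ 𝓔.H := fun x =>
    hY.comp_mem 𝓔 (hφ.prod_right x)
  obtain ⟨C, hC, m, h⟩ := hφ
  have hN : (fun ω => ‖Y ω‖ ^ m) ∈ 𝓔.H := hY.comp_mem 𝓔 (isCLLip_norm_pow m)
  set D := 𝓔.E (fun ω => ‖Y ω‖ ^ m) with hD
  have hD0 : 0 ≤ D := by
    rw [← 𝓔.const_preserving 0]
    exact 𝓔.mono _ hN _ (𝓔.const_mem 0) fun ω => by positivity
  have hn : ∀ (x : V) (y : W), ‖(x, y)‖ ^ m ≤ ‖x‖ ^ m + ‖y‖ ^ m := by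
    intro x y
    have hx : 0 ≤ ‖x‖ ^ m := by positivity
    have hy : 0 ≤ ‖y‖ ^ m := by positivity
    rw [Prod.norm_def]
    rcases max_choice ‖x‖ ‖y‖ with h | h <;> simp only [h] <;> linarith
  have key : ∀ x y : V, 𝓔.E (fun ω => φ (x, Y ω)) - 𝓔.E (fun ω => φ (y, Y ω)) ≤
      C * (1 + 2 * D) * (1 + ‖x‖ ^ m + ‖y‖ ^ m) * ‖x - y‖ := by
    intro x y
    set a := C * (1 + ‖x‖ ^ m + ‖y‖ ^ m) * ‖x - y‖ with ha
    set b := C * 2 * ‖x - y‖ with hb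
    have hb0 : 0 ≤ b := by positivity
    have hbN : (fun ω => b * ‖Y ω‖ ^ m) ∈ 𝓔.H := 𝓔.H.smul_mem b hN
    have hG : (fun ω => a + b * ‖Y ω‖ ^ m) ∈ 𝓔.H := 𝓔.H.add_mem (𝓔.const_mem a) hbN
    have h1 : 𝓔.E (fun ω => φ (x, Y ω)) ≤
        𝓔.E (fun ω => φ (y, Y ω) + (a + b * ‖Y ω‖ ^ m)) := by
      refine 𝓔.mono _ (𝓔.H.add_mem (hF y) hG) _ (hF x) fun ω => ?_
      have h2 := (le_abs_self _).trans (h (x, Y ω) (y, Y ω))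
      have e : ‖(x, Y ω) - (y, Y ω)‖ = ‖x - y‖ := by simp [Prod.norm_def]
      rw [e] at h2
      have h3 : C * (1 + ‖(x, Y ω)‖ ^ m + ‖(y, Y ω)‖ ^ m) * ‖x - y‖ ≤
          C * (1 + (‖x‖ ^ m + ‖Y ω‖ ^ m) + (‖y‖ ^ m + ‖Y ω‖ ^ m)) * ‖x - y‖ := by
        gcongr
        · exact hn x (Y ω)
        · exact hn y (Y ω)
      have h4 : C * (1 + (‖x‖ ^ m + ‖Y ω‖ ^ m) + (‖y‖ ^ m + ‖Y ω‖ ^ m)) * ‖x - y‖ =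
          a + b * ‖Y ω‖ ^ m := by rw [ha, hb]; ring
      change φ (x, Y ω) ≤ φ (y, Y ω) + (a + b * ‖Y ω‖ ^ m)
      linarith
    have h5 := 𝓔.sub_additive _ (hF y) _ hG
    have h6 := 𝓔.sub_additive _ (𝓔.const_mem a) _ hbN
    rw [𝓔.const_preserving, 𝓔.pos_homogeneous _ hN b hb0] at h6
    have h7 : a + b * D ≤ C * (1 + 2 * D) * (1 + ‖x‖ ^ m + ‖y‖ ^ m) * ‖x - y‖ := by
      have : 0 ≤ C * (2 * D) * (‖x‖ ^ m + ‖y‖ ^ m) * ‖x - y‖ := by positivity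
      rw [ha, hb]
      linarith
    linarith
  refine ⟨C * (1 + 2 * D), by positivity, m, fun x y => abs_le.2 ⟨?_, key x y⟩⟩
  have := key y x
  rw [norm_sub_rev y x] at this
  linarith

end SublinearExpSpace

/-! ### Hausdorff distance of compact sets -/

open scoped Pointwise

section Geometry

variable {V : Type*} [NormedAddCommGroup V] [InnerProductSpace ℝ V]

/-! Nonempty compact sets are complete for the Hausdorff distance, which gives `Γ`, and convexity
passes to the limit. Put `ε i = d_H(Γ, Γ_i)`: up to the error `ε i * ‖p‖`, the mean function
`g_i(p)` is the support function of `Γ`. The law of large numbers then follows from second moments.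

Upper bound (`E_infDist_sq_add_le`): follow `E[dist(S_k, kΓ)²]`. If `z` is the point of `kΓ` nearest
to `x`, `p = x - z`, and `q ∈ Γ` maximises `⟨q, p⟩`, then `z + q ∈ (k+1)Γ` by convexity. Expanding
`‖p + (Y - q)‖²`, the cross term has expectation at most `2 ε ‖p‖` and the last term is bounded.

Lower bound (`le_E_neg_norm_sq_add`): for `y ∈ Γ`, the same expansion bounds `-E[-‖S_k - k y‖²]`, as
if one chose a scenario whose conditional mean pushes the sum back towards `k y`.

Young's inequality with weight `n`, independence and Grönwall bound both quantities at time `n` by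
`e (n C + n ∑ ε_k²)`; divided by `n²`, this vanishes by Cesàro. A Lipschitz `φ` exceeds its maximum
over `Γ` by at most `K dist(S_n/n, Γ)`, and falls below its value at a maximiser `y` by at most `K
‖S_n/n - y‖`. -/

theorem IsCompact.exists_dist_le_hausdorffDist {α : Type*} [PseudoMetricSpace α] {S T : Set α}
    (hS : IsCompact S) (hSn : S.Nonempty) (hT : Bornology.IsBounded T) {q : α} (hq : q ∈ T) :
    ∃ q' ∈ S, dist q q' ≤ Metric.hausdorffDist S T := by
  obtain ⟨q', hq', h⟩ := hS.exists_infDist_eq_dist hSn q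
  refine ⟨q', hq', ?_⟩
  rw [← h, Metric.hausdorffDist_comm]
  exact Metric.infDist_le_hausdorffDist_of_mem hq
    (Metric.hausdorffEDist_ne_top_of_nonempty_of_bounded ⟨q, hq⟩ hSn hT hS.isBounded)

theorem IsCompact.exists_inner_le_add_hausdorffDist {S T : Set V}
    (hS : IsCompact S) (hSn : S.Nonempty) (hT : Bornology.IsBounded T) {q : V} (hq : q ∈ T)
    (p : V) :
    ∃ q' ∈ S, inner ℝ q p ≤ inner ℝ q' p + Metric.hausdorffDist S T * ‖p‖ := by
  obtain ⟨q', hq', h⟩ := hS.exists_dist_le_hausdorffDist hSn hT hq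
  refine ⟨q', hq', ?_⟩
  have h1 : inner ℝ (q - q') p ≤ ‖q - q'‖ * ‖p‖ := real_inner_le_norm _ _
  rw [inner_sub_left, ← dist_eq_norm] at h1
  nlinarith [norm_nonneg p]

/-- A limit of convex sets for the Hausdorff distance is convex. -/
theorem convex_of_tendsto_hausdorffDist {S : Set V} {T : ℕ → Set V} (hS : IsCompact S)
    (hT : ∀ i, IsCompact (T i)) (hTn : ∀ i, (T i).Nonempty) (hTc : ∀ i, Convex ℝ (T i))
    (h : Tendsto (fun i => Metric.hausdorffDist S (T i)) atTop (𝓝 0)) : Convex ℝ S := by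
  intro x hx y hy a b ha hb hab
  -- One Hausdorff distance to move `x` and `y` into `T i` (the weights sum to 1), one to come back
  -- to `S`.
  have key : ∀ i, Metric.infDist (a • x + b • y) S ≤ 2 * Metric.hausdorffDist S (T i) := by
    intro i
    obtain ⟨x', hx', hxd⟩ := (hT i).exists_dist_le_hausdorffDist (hTn i) hS.isBounded hx
    obtain ⟨y', hy', hyd⟩ := (hT i).exists_dist_le_hausdorffDist (hTn i) hS.isBounded hy
    obtain ⟨z, hz, hzd⟩ := hS.exists_dist_le_hausdorffDist ⟨x, hx⟩ (hT i).isBounded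
      (hTc i hx' hy' ha hb hab)
    rw [Metric.hausdorffDist_comm] at hxd hyd
    have h1 : dist (a • x + b • y) (a • x' + b • y') ≤ a * dist x x' + b * dist y y' := by
      refine (dist_add_add_le _ _ _ _).trans ?_
      rw [dist_smul₀, dist_smul₀, Real.norm_of_nonneg ha, Real.norm_of_nonneg hb]
    have h2 := dist_triangle (a • x + b • y) (a • x' + b • y') z
    have h3 := Metric.infDist_le_dist_of_mem (x := a • x + b • y) hz
    have h4 : a * Metric.hausdorffDist S (T i) + b * Metric.hausdorffDist S (T i) =
        Metric.hausdorffDist S (T i) := by rw [← add_mul, hab, one_mul]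
    linarith [mul_le_mul_of_nonneg_left hxd ha, mul_le_mul_of_nonneg_left hyd hb]
  have h0 : Metric.infDist (a • x + b • y) S ≤ 0 := by
    have h2 := h.const_mul 2
    rw [mul_zero] at h2
    exact ge_of_tendsto' h2 key
  exact (hS.isClosed.mem_iff_infDist_zero ⟨x, hx⟩).2 (le_antisymm h0 Metric.infDist_nonneg)

theorem exists_isCompact_tendsto_hausdorffDist {α : Type*} [MetricSpace α] [CompleteSpace α]
    {T : ℕ → Set α} (hT : ∀ i, IsCompact (T i)) (hTn : ∀ i, (T i).Nonempty)
    (h : ∀ ε > 0, ∃ N : ℕ, ∀ i ≥ N, ∀ j ≥ N, Metric.hausdorffDist (T i) (T j) < ε) :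
    ∃ S : Set α, IsCompact S ∧ S.Nonempty ∧
      Tendsto (fun i => Metric.hausdorffDist S (T i)) atTop (𝓝 0) := by
  let K : ℕ → TopologicalSpace.NonemptyCompacts α := fun i => ⟨⟨T i, hT i⟩, hTn i⟩
  have hK : CauchySeq K := by
    refine Metric.cauchySeq_iff.2 fun ε hε => ?_
    obtain ⟨N, hN⟩ := h ε hε
    -- The metric on `NonemptyCompacts` is the Hausdorff distance by definition.
    exact ⟨N, fun i hi j hj => hN i hi j hj⟩
  obtain ⟨L, hL⟩ := cauchySeq_tendsto_of_complete hK
  refine ⟨L, L.isCompact, L.nonempty, ?_⟩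
  have := tendsto_iff_dist_tendsto_zero.1 hL
  simp only [dist_comm (K _) L] at this
  exact this

theorem isCLLip_infDist_sq {V : Type*} [NormedAddCommGroup V] {S : Set V} (hS : S.Nonempty) :
    IsCLLip (fun x => Metric.infDist x S ^ 2) := by
  obtain ⟨s, hs⟩ := hS
  refine ⟨1 + 2 * ‖s‖, by positivity, 1, fun x y => ?_⟩
  have hle : ∀ x, Metric.infDist x S ≤ ‖x‖ + ‖s‖ := fun x =>
    (Metric.infDist_le_dist_of_mem hs).trans (by rw [dist_eq_norm]; exact norm_sub_le _ _)
  have h1 : |Metric.infDist x S - Metric.infDist y S| ≤ ‖x - y‖ := by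
    have := (Metric.lipschitz_infDist_pt S).dist_le_mul x y
    simpa [Real.dist_eq, dist_eq_norm] using this
  have h0 := Metric.infDist_nonneg (x := x) (s := S)
  have h0' := Metric.infDist_nonneg (x := y) (s := S)
  rw [sq_sub_sq, abs_mul, abs_of_nonneg (add_nonneg h0 h0')]
  refine mul_le_mul ?_ h1 (abs_nonneg _) (by positivity)
  have := hle x
  have := hle y
  simp only [pow_one]
  nlinarith [norm_nonneg x, norm_nonneg y, norm_nonneg s]

theorem norm_sub_sq_le (y q : V) : ‖y - q‖ ^ 2 ≤ 2 * ‖q‖ ^ 2 + 2 * ‖y‖ ^ 2 := by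
  have h := parallelogram_law_with_norm ℝ y q
  nlinarith [sq_nonneg ‖y + q‖]

end Geometry

theorem IsCLLip.neg {V : Type*} [NormedAddCommGroup V] {φ : V → ℝ} (h : IsCLLip φ) :
    IsCLLip (fun x => -φ x) := by
  obtain ⟨C, hC, m, h⟩ := h
  refine ⟨C, hC, m, fun x y => ?_⟩
  rw [neg_sub_neg, abs_sub_comm]
  exact h x y

theorem IsCLLip.comp_const_add {V : Type*} [NormedAddCommGroup V] {φ : V → ℝ}
    (h : IsCLLip φ) (x : V) : IsCLLip (fun y => φ (x + y)) := by
  obtain ⟨C, hC, m, h⟩ := h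
  have hb : ∀ y : V, ‖x + y‖ ^ m ≤ 2 ^ (m - 1) * (‖x‖ ^ m + ‖y‖ ^ m) := fun y =>
    (pow_le_pow_left₀ (norm_nonneg _) (norm_add_le _ _) m).trans
      (add_pow_le (norm_nonneg _) (norm_nonneg _) m)
  set A : ℝ := 2 ^ (m - 1) with hA
  have hA0 : 0 ≤ A := by positivity
  refine ⟨C * (1 + A + 2 * A * ‖x‖ ^ m), by positivity, m, fun y z => (h _ _).trans ?_⟩
  rw [add_sub_add_left_eq_sub]
  refine mul_le_mul_of_nonneg_right ?_ (norm_nonneg _)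
  rw [mul_assoc]
  refine mul_le_mul_of_nonneg_left ?_ hC.le
  have hx : 0 ≤ A * ‖x‖ ^ m := by positivity
  have hy : 0 ≤ ‖y‖ ^ m := by positivity
  have hz : 0 ≤ ‖z‖ ^ m := by positivity
  nlinarith [hb y, hb z, mul_nonneg hx hy, mul_nonneg hx hz]

/-- A discrete Grönwall inequality. -/
theorem le_pow_mul_sum_of_succ_le {u c : ℕ → ℝ} {a : ℝ} (ha : 1 ≤ a) (hc : ∀ k, 0 ≤ c k)
    (h0 : u 0 ≤ 0) (h : ∀ k, u (k + 1) ≤ a * u k + c k) (n : ℕ) :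
    u n ≤ a ^ n * ∑ k ∈ Finset.range n, c k := by
  induction n with
  | zero => simpa using h0
  | succ n ih =>
    have h1 : c n ≤ a ^ (n + 1) * c n := le_mul_of_one_le_left (hc n) (one_le_pow₀ ha)
    have h2 := mul_le_mul_of_nonneg_left ih (zero_le_one.trans ha)
    rw [Finset.sum_range_succ, mul_add, pow_succ']
    rw [pow_succ'] at h1
    have := h n
    linarith

/-! ### Conditioning and one-step estimates -/

namespace SublinearExpSpace

variable {Ω : Type*} (𝓔 : SublinearExpSpace Ω)

theorem add_const_mem {X : Ω → ℝ} (hX : X ∈ 𝓔.H) (c : ℝ) : (fun ω => X ω + c) ∈ 𝓔.H :=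
  𝓔.H.add_mem hX (𝓔.const_mem c)

theorem const_mul_mem {X : Ω → ℝ} (hX : X ∈ 𝓔.H) (c : ℝ) : (fun ω => c * X ω) ∈ 𝓔.H :=
  𝓔.H.smul_mem c hX

theorem E_add_const_le {X : Ω → ℝ} (hX : X ∈ 𝓔.H) (c : ℝ) :
    𝓔.E (fun ω => X ω + c) ≤ 𝓔.E X + c := by
  simpa [𝓔.const_preserving] using 𝓔.sub_additive X hX _ (𝓔.const_mem c)

theorem E_add_const {X : Ω → ℝ} (hX : X ∈ 𝓔.H) (c : ℝ) :
    𝓔.E (fun ω => X ω + c) = 𝓔.E X + c := by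
  refine le_antisymm (𝓔.E_add_const_le hX c) ?_
  have := 𝓔.E_add_const_le (𝓔.add_const_mem hX c) (-c)
  simp only [add_neg_cancel_right] at this
  linarith

theorem E_affine {X : Ω → ℝ} (hX : X ∈ 𝓔.H) {a : ℝ} (ha : 0 ≤ a) (c : ℝ) :
    𝓔.E (fun ω => a * X ω + c) = a * 𝓔.E X + c := by
  rw [𝓔.E_add_const (𝓔.const_mul_mem hX a), 𝓔.pos_homogeneous X hX a ha]

variable {V : Type*} [NormedAddCommGroup V] [InnerProductSpace ℝ V]

variable {𝓔} in
theorem IsRandomVector.sum {ι : Type*} {Y : ι → Ω → V} (hY : ∀ i, 𝓔.IsRandomVector (Y i))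
    (s : Finset ι) : 𝓔.IsRandomVector (fun ω => ∑ i ∈ s, Y i ω) := by
  intro l
  have : (fun ω => l (∑ i ∈ s, Y i ω)) = ∑ i ∈ s, fun ω => l (Y i ω) := by
    ext ω; simp [Finset.sum_apply]
  rw [this]
  exact 𝓔.H.sum_mem fun i _ => hY i l

variable {𝓔} in
theorem IsRandomVector.inner_mem {X : Ω → V} (hX : 𝓔.IsRandomVector X) (p : V) :
    (fun ω => inner ℝ (X ω) p) ∈ 𝓔.H := by
  simpa [real_inner_comm] using hX (innerSL ℝ p)

/-- Conditioning the partial sum `S (k + 1)` on `S k`. -/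
theorem E_sum_range_succ {Y : ℕ → Ω → V}
    (hindep : ∀ i : ℕ, 𝓔.IndepFrom (Y (i + 1)) (fun ω (j : Fin (i + 1)) => Y j ω))
    {ψ : V → ℝ} (hψ : IsCLLip ψ) (k : ℕ) :
    𝓔.E (fun ω => ψ (∑ i ∈ Finset.range (k + 1), Y i ω)) =
      𝓔.E (fun ω => 𝓔.E (fun ω' => ψ (∑ i ∈ Finset.range k, Y i ω + Y k ω'))) := by
  cases k with
  -- The sum is empty, so no independence is needed: the outer expectation is that of a constant.
  | zero => simp [𝓔.const_preserving]
  | succ k =>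
    let f : (Fin (k + 1) → V) × V →L[ℝ] V :=
      (∑ j, ContinuousLinearMap.proj (R := ℝ) (φ := fun _ : Fin (k + 1) => V) j).comp
        (ContinuousLinearMap.fst ℝ _ _) + ContinuousLinearMap.snd ℝ _ _
    have hf : ∀ z y, f (z, y) = ∑ j, z j + y := fun z y => by simp [f]
    have h := hindep k _ (hψ.comp_clm f)
    have hs : ∀ ω, ∑ j : Fin (k + 1), Y j ω = ∑ i ∈ Finset.range (k + 1), Y i ω := fun ω =>
      Fin.sum_univ_eq_sum_range (fun j => Y j ω) (k + 1)
    simp only [hf, hs] at h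
    simpa only [Finset.sum_range_succ _ (k + 1)] using h

variable [FiniteDimensional ℝ V]

theorem isCLLip_E_add {Y : Ω → V} (hY : 𝓔.IsRandomVector Y) {ψ : V → ℝ} (hψ : IsCLLip ψ) :
    IsCLLip (fun x => 𝓔.E (fun ω => ψ (x + Y ω))) :=
  hY.isCLLip_partial 𝓔
    (hψ.comp_clm (ContinuousLinearMap.fst ℝ V V + ContinuousLinearMap.snd ℝ V V))

/-- Independence freezes the past at a point `x`, so a bound uniform in `x` integrates to a
recursion for the partial sums. -/
theorem E_sum_range_succ_le {Y : ℕ → Ω → V} (hY : ∀ i, 𝓔.IsRandomVector (Y i))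
    (hindep : ∀ i : ℕ, 𝓔.IndepFrom (Y (i + 1)) (fun ω (j : Fin (i + 1)) => Y j ω))
    {ψ ψ' : V → ℝ} (hψ : IsCLLip ψ) (hψ' : IsCLLip ψ') {k : ℕ} {a c : ℝ} (ha : 0 ≤ a)
    (h : ∀ x, 𝓔.E (fun ω => ψ' (x + Y k ω)) ≤ a * ψ x + c) :
    𝓔.E (fun ω => ψ' (∑ i ∈ Finset.range (k + 1), Y i ω)) ≤
      a * 𝓔.E (fun ω => ψ (∑ i ∈ Finset.range k, Y i ω)) + c := by
  have hS := IsRandomVector.sum hY (Finset.range k)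
  have hm := hS.comp_mem 𝓔 hψ
  rw [𝓔.E_sum_range_succ hindep hψ', ← 𝓔.E_affine hm ha]
  exact 𝓔.mono _ (𝓔.add_const_mem (𝓔.const_mul_mem hm a) c) _
    (hS.comp_mem 𝓔 (𝓔.isCLLip_E_add (hY k) hψ')) fun ω => h _

theorem le_E_sum_range_succ {Y : ℕ → Ω → V} (hY : ∀ i, 𝓔.IsRandomVector (Y i))
    (hindep : ∀ i : ℕ, 𝓔.IndepFrom (Y (i + 1)) (fun ω (j : Fin (i + 1)) => Y j ω))
    {ψ ψ' : V → ℝ} (hψ : IsCLLip ψ) (hψ' : IsCLLip ψ') {k : ℕ} {a c : ℝ} (ha : 0 ≤ a)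
    (h : ∀ x, a * ψ x + c ≤ 𝓔.E (fun ω => ψ' (x + Y k ω))) :
    a * 𝓔.E (fun ω => ψ (∑ i ∈ Finset.range k, Y i ω)) + c ≤
      𝓔.E (fun ω => ψ' (∑ i ∈ Finset.range (k + 1), Y i ω)) := by
  have hS := IsRandomVector.sum hY (Finset.range k)
  have hm := hS.comp_mem 𝓔 hψ
  rw [𝓔.E_sum_range_succ hindep hψ', ← 𝓔.E_affine hm ha]
  exact 𝓔.mono _ (hS.comp_mem 𝓔 (𝓔.isCLLip_E_add (hY k) hψ')) _
    (𝓔.add_const_mem (𝓔.const_mul_mem hm a) c) fun ω => h _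

theorem norm_sub_sq_mem {Y : Ω → V} (hY : 𝓔.IsRandomVector Y) (q : V) :
    (fun ω => ‖Y ω - q‖ ^ 2) ∈ 𝓔.H := by
  simpa [sub_eq_add_neg, add_comm] using
    hY.comp_mem 𝓔 ((isCLLip_norm_pow 2).comp_const_add (-q))

/-- `E[|Y - q|²] ≤ 2 |q|² + 2 E[|Y|²]`. -/
theorem E_norm_sub_sq_le {Y : Ω → V} (hY : 𝓔.IsRandomVector Y) (q : V) :
    𝓔.E (fun ω => ‖Y ω - q‖ ^ 2) ≤ 2 * ‖q‖ ^ 2 + 2 * 𝓔.E (fun ω => ‖Y ω‖ ^ 2) := by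
  have hm := hY.comp_mem 𝓔 (isCLLip_norm_pow 2)
  have h := 𝓔.E_affine hm (zero_le_two) (2 * ‖q‖ ^ 2)
  rw [add_comm (2 * ‖q‖ ^ 2), ← h]
  refine 𝓔.mono _ (𝓔.add_const_mem (𝓔.const_mul_mem hm 2) _) _ (𝓔.norm_sub_sq_mem hY q)
    fun ω => ?_
  have := norm_sub_sq_le (Y ω) q
  linarith

/-- One step of the upper estimate. -/
theorem E_infDist_sq_add_le {Y : Ω → V} (hY : 𝓔.IsRandomVector Y) {Γ : Set V}
    (hΓ : IsCompact Γ) (hΓn : Γ.Nonempty) (hΓc : Convex ℝ Γ) {ε C b : ℝ} (hb : 0 < b)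
    (hg : ∀ p, ∃ q ∈ Γ, 𝓔.E (fun ω => inner ℝ (Y ω) p) ≤ inner ℝ q p + ε * ‖p‖)
    (hC : ∀ q ∈ Γ, 𝓔.E (fun ω => ‖Y ω - q‖ ^ 2) ≤ C) (k : ℕ) (x : V) :
    𝓔.E (fun ω => Metric.infDist (x + Y ω) (((k + 1 : ℕ) : ℝ) • Γ) ^ 2) ≤
      (1 + b⁻¹) * Metric.infDist x ((k : ℝ) • Γ) ^ 2 + (C + b * ε ^ 2) := by
  obtain ⟨z, hz, hzx⟩ := (hΓ.smul (k : ℝ)).exists_infDist_eq_dist (hΓn.smul_set) x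
  rw [hzx, dist_eq_norm]
  set p := x - z with hp
  obtain ⟨q, hq, hqp⟩ := hg p
  -- Convexity is essential here: it gives `(k + 1)Γ = kΓ + Γ`.
  have hmem : z + q ∈ ((k + 1 : ℕ) : ℝ) • Γ := by
    rw [Nat.cast_add, Nat.cast_one, hΓc.add_smul (Nat.cast_nonneg k) zero_le_one, one_smul]
    exact Set.add_mem_add hz hq
  have hI := hY.inner_mem p
  have hN := 𝓔.norm_sub_sq_mem hY q
  have hI' := 𝓔.add_const_mem (𝓔.const_mul_mem hI 2) (‖p‖ ^ 2 - 2 * inner ℝ q p)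
  have h1 : 𝓔.E (fun ω => Metric.infDist (x + Y ω) (((k + 1 : ℕ) : ℝ) • Γ) ^ 2) ≤
      𝓔.E (fun ω => (2 * inner ℝ (Y ω) p + (‖p‖ ^ 2 - 2 * inner ℝ q p)) + ‖Y ω - q‖ ^ 2) := by
    refine 𝓔.mono _ (𝓔.H.add_mem hI' hN) _
      (hY.comp_mem 𝓔 ((isCLLip_infDist_sq hΓn.smul_set).comp_const_add x)) fun ω => ?_
    have h2 : Metric.infDist (x + Y ω) (((k + 1 : ℕ) : ℝ) • Γ) ≤ ‖p + (Y ω - q)‖ := by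
      refine (Metric.infDist_le_dist_of_mem hmem).trans_eq ?_
      rw [dist_eq_norm, hp]; congr 1; abel
    refine (pow_le_pow_left₀ Metric.infDist_nonneg h2 2).trans_eq ?_
    rw [norm_add_sq_real, inner_sub_right, real_inner_comm, real_inner_comm q, Pi.add_apply]; ring
  have h2 := 𝓔.sub_additive _ hI' _ hN
  rw [𝓔.E_affine hI zero_le_two] at h2
  have h3 := hC q hq
  -- Young's inequality; the weight `b` will be the final time `n`.
  have h4 : 2 * (ε * ‖p‖) ≤ b⁻¹ * ‖p‖ ^ 2 + b * ε ^ 2 := by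
    have : 0 ≤ b⁻¹ * (‖p‖ - b * ε) ^ 2 := by positivity
    have e : b⁻¹ * (‖p‖ - b * ε) ^ 2 = b⁻¹ * ‖p‖ ^ 2 + b * ε ^ 2 - 2 * (ε * ‖p‖) := by
      field_simp; ring
    linarith
  linarith

/-- One step of the lower estimate. -/
theorem le_E_neg_norm_sq_add {Y : Ω → V} (hY : 𝓔.IsRandomVector Y) {y : V} {ε C b : ℝ}
    (hb : 0 < b) (hg : ∀ p, inner ℝ y p ≤ 𝓔.E (fun ω => inner ℝ (Y ω) p) + ε * ‖p‖)
    (hC : 𝓔.E (fun ω => ‖Y ω - y‖ ^ 2) ≤ C) (k : ℕ) (x : V) :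
    (1 + b⁻¹) * -‖x - (k : ℝ) • y‖ ^ 2 + -(C + b * ε ^ 2) ≤
      𝓔.E (fun ω => -‖x + Y ω - ((k + 1 : ℕ) : ℝ) • y‖ ^ 2) := by
  -- Pointing from `x` to `k y`, so that `⟨Y, p⟩` enters with a positive coefficient.
  set p := (k : ℝ) • y - x with hp
  have hI := hY.inner_mem p
  have hN := 𝓔.norm_sub_sq_mem hY y
  have hI' := 𝓔.add_const_mem (𝓔.const_mul_mem hI 2) (-‖p‖ ^ 2 - 2 * inner ℝ y p)
  have e : ∀ ω, -‖x + Y ω - ((k + 1 : ℕ) : ℝ) • y‖ ^ 2 + ‖Y ω - y‖ ^ 2 =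
      2 * inner ℝ (Y ω) p + (-‖p‖ ^ 2 - 2 * inner ℝ y p) := fun ω => by
    have : x + Y ω - ((k + 1 : ℕ) : ℝ) • y = (Y ω - y) - p := by
      rw [hp, Nat.cast_add, Nat.cast_one, add_smul, one_smul]; abel
    rw [this, norm_sub_sq_real, inner_sub_left]; ring
  have hL : (fun ω => -‖x + Y ω - ((k + 1 : ℕ) : ℝ) • y‖ ^ 2) ∈ 𝓔.H := by
    have := 𝓔.H.sub_mem hI' hN
    convert this using 1
    funext ω
    exact eq_sub_of_add_eq (e ω)
  -- Sub-additivity read backwards: `E[L] ≥ E[L + N] - E[N]`, where `L + N` is affine in `Y`.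
  have h2 := 𝓔.sub_additive _ hL _ hN
  simp only [e] at h2
  rw [𝓔.E_affine hI zero_le_two] at h2
  have h4 : 2 * (ε * ‖p‖) ≤ b⁻¹ * ‖p‖ ^ 2 + b * ε ^ 2 := by
    have : 0 ≤ b⁻¹ * (‖p‖ - b * ε) ^ 2 := by positivity
    have e : b⁻¹ * (‖p‖ - b * ε) ^ 2 = b⁻¹ * ‖p‖ ^ 2 + b * ε ^ 2 - 2 * (ε * ‖p‖) := by
      field_simp; ring
    linarith
  have h5 : ‖x - (k : ℝ) • y‖ = ‖p‖ := norm_sub_rev _ _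
  have := hg p
  rw [h5]
  linarith

end SublinearExpSpace

/-! ### Asymptotics of the error and the law of large numbers -/

theorem tendsto_inv_sq_mul_pow_mul_sum {ε : ℕ → ℝ} (hε : Tendsto ε atTop (𝓝 0)) {C : ℝ}
    (hC : 0 ≤ C) :
    Tendsto (fun n : ℕ => ((n : ℝ)⁻¹) ^ 2 *
      ((1 + (n : ℝ)⁻¹) ^ n * ∑ k ∈ Finset.range n, (C + n * ε k ^ 2))) atTop (𝓝 0) := by
  have h1 : Tendsto (fun n : ℕ => Real.exp 1 *
      (C * (n : ℝ)⁻¹ + (n : ℝ)⁻¹ * ∑ k ∈ Finset.range n, ε k ^ 2)) atTop (𝓝 0) := by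
    have h2 : Tendsto (fun k => ε k ^ 2) atTop (𝓝 0) := by simpa using hε.pow 2
    simpa using ((tendsto_inv_atTop_nhds_zero_nat (𝕜 := ℝ)).const_mul C
      |>.add h2.cesaro).const_mul (Real.exp 1)
  refine squeeze_zero' (Eventually.of_forall fun n => by positivity) ?_ h1
  filter_upwards [eventually_gt_atTop 0] with n hn
  have hn' : (0 : ℝ) < n := Nat.cast_pos.2 hn
  have h3 : (1 + (n : ℝ)⁻¹) ^ n ≤ Real.exp 1 := by
    rw [add_comm]
    refine (pow_le_pow_left₀ (by positivity) (Real.add_one_le_exp _) n).trans_eq ?_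
    rw [← Real.exp_nat_mul, mul_inv_cancel₀ hn'.ne']
  have h4 : ∑ k ∈ Finset.range n, (C + n * ε k ^ 2) =
      n * C + n * ∑ k ∈ Finset.range n, ε k ^ 2 := by
    rw [Finset.sum_add_distrib, Finset.mul_sum]; simp
  have h5 : 0 ≤ ∑ k ∈ Finset.range n, ε k ^ 2 := Finset.sum_nonneg fun _ _ => sq_nonneg _
  rw [h4]
  calc ((n : ℝ)⁻¹) ^ 2 * ((1 + (n : ℝ)⁻¹) ^ n * (n * C + n * ∑ k ∈ Finset.range n, ε k ^ 2))
      ≤ ((n : ℝ)⁻¹) ^ 2 * (Real.exp 1 * (n * C + n * ∑ k ∈ Finset.range n, ε k ^ 2)) := by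
        gcongr
    _ = _ := by field_simp

/-- Converts a distance, the Lipschitz cost, into the squared distance that the estimates control.
-/
theorem le_add_inv_mul_sq {t δ : ℝ} (hδ : 0 < δ) : t ≤ δ + δ⁻¹ * t ^ 2 := by
  have : 0 ≤ δ⁻¹ * (t - δ) ^ 2 := by positivity
  have e : δ⁻¹ * (t - δ) ^ 2 = δ⁻¹ * t ^ 2 + δ - 2 * t := by field_simp; ring
  nlinarith [mul_nonneg (inv_nonneg.2 hδ.le) (sq_nonneg t)]

namespace SublinearExpSpace

section LawOfLargeNumbers

variable {Ω : Type*} (𝓔 : SublinearExpSpace Ω) {V : Type*} [NormedAddCommGroup V]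
  [InnerProductSpace ℝ V] [FiniteDimensional ℝ V]

theorem E_infDist_sum_sq_le {Y : ℕ → Ω → V} (hY : ∀ i, 𝓔.IsRandomVector (Y i))
    (hindep : ∀ i : ℕ, 𝓔.IndepFrom (Y (i + 1)) (fun ω (j : Fin (i + 1)) => Y j ω))
    {Γ : Set V} (hΓ : IsCompact Γ) (hΓn : Γ.Nonempty) (hΓc : Convex ℝ Γ)
    {ε : ℕ → ℝ} {C : ℝ} (hC0 : 0 ≤ C)
    (hg : ∀ i p, ∃ q ∈ Γ, 𝓔.E (fun ω => inner ℝ (Y i ω) p) ≤ inner ℝ q p + ε i * ‖p‖)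
    (hC : ∀ i, ∀ q ∈ Γ, 𝓔.E (fun ω => ‖Y i ω - q‖ ^ 2) ≤ C) {n : ℕ} (hn : 0 < n) :
    𝓔.E (fun ω => Metric.infDist (∑ i ∈ Finset.range n, Y i ω) ((n : ℝ) • Γ) ^ 2) ≤
      (1 + (n : ℝ)⁻¹) ^ n * ∑ k ∈ Finset.range n, (C + n * ε k ^ 2) := by
  have hn' : (0 : ℝ) < n := Nat.cast_pos.2 hn
  refine le_pow_mul_sum_of_succ_le (u := fun k => 𝓔.E (fun ω =>
    Metric.infDist (∑ i ∈ Finset.range k, Y i ω) ((k : ℝ) • Γ) ^ 2))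
    (c := fun k => C + n * ε k ^ 2) (by simp) (fun k => by positivity) ?_ (fun k => ?_) n
  -- At `k = 0` both the sum and `0 • Γ = {0}` are trivial.
  · simp [𝓔.const_preserving, Set.zero_smul_set hΓn, ← Set.singleton_zero]
  · exact 𝓔.E_sum_range_succ_le hY hindep (isCLLip_infDist_sq hΓn.smul_set)
      (isCLLip_infDist_sq hΓn.smul_set) (by positivity)
      (𝓔.E_infDist_sq_add_le (hY k) hΓ hΓn hΓc hn' (hg k) (hC k) k)

theorem le_E_neg_norm_sum_sub_sq {Y : ℕ → Ω → V} (hY : ∀ i, 𝓔.IsRandomVector (Y i))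
    (hindep : ∀ i : ℕ, 𝓔.IndepFrom (Y (i + 1)) (fun ω (j : Fin (i + 1)) => Y j ω))
    {y : V} {ε : ℕ → ℝ} {C : ℝ} (hC0 : 0 ≤ C)
    (hg : ∀ i p, inner ℝ y p ≤ 𝓔.E (fun ω => inner ℝ (Y i ω) p) + ε i * ‖p‖)
    (hC : ∀ i, 𝓔.E (fun ω => ‖Y i ω - y‖ ^ 2) ≤ C) {n : ℕ} (hn : 0 < n) :
    -((1 + (n : ℝ)⁻¹) ^ n * ∑ k ∈ Finset.range n, (C + n * ε k ^ 2)) ≤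
      𝓔.E (fun ω => -‖∑ i ∈ Finset.range n, Y i ω - (n : ℝ) • y‖ ^ 2) := by
  have hn' : (0 : ℝ) < n := Nat.cast_pos.2 hn
  have hL : ∀ z : V, IsCLLip (fun x => -‖x - z‖ ^ 2) := fun z => by
    have := ((isCLLip_norm_pow 2).comp_const_add (-z)).neg
    simpa only [neg_add_eq_sub] using this
  rw [neg_le]
  refine le_pow_mul_sum_of_succ_le (u := fun k => -𝓔.E (fun ω =>
    -‖∑ i ∈ Finset.range k, Y i ω - (k : ℝ) • y‖ ^ 2))
    (c := fun k => C + n * ε k ^ 2) (by simp) (fun k => by positivity) ?_ (fun k => ?_) n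
  · simp [𝓔.const_preserving]
  · have := 𝓔.le_E_sum_range_succ hY hindep (hL ((k : ℝ) • y)) (hL (((k + 1 : ℕ) : ℝ) • y))
      (by positivity) (𝓔.le_E_neg_norm_sq_add (hY k) hn' (hg k) (hC k) k)
    linarith

/-- The law of large numbers, for vectors whose means are asymptotically described by `Γ`. -/
theorem tendsto_E_average {Y : ℕ → Ω → V} (hY : ∀ i, 𝓔.IsRandomVector (Y i))
    (hindep : ∀ i : ℕ, 𝓔.IndepFrom (Y (i + 1)) (fun ω (j : Fin (i + 1)) => Y j ω))
    {Γ : Set V} (hΓ : IsCompact Γ) (hΓc : Convex ℝ Γ)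
    {ε : ℕ → ℝ} (hε : Tendsto ε atTop (𝓝 0)) {C : ℝ} (hC0 : 0 ≤ C)
    (hgle : ∀ i p, ∃ q ∈ Γ, 𝓔.E (fun ω => inner ℝ (Y i ω) p) ≤ inner ℝ q p + ε i * ‖p‖)
    (hleg : ∀ i, ∀ q ∈ Γ, ∀ p, inner ℝ q p ≤ 𝓔.E (fun ω => inner ℝ (Y i ω) p) + ε i * ‖p‖)
    (hC : ∀ i, ∀ q ∈ Γ, 𝓔.E (fun ω => ‖Y i ω - q‖ ^ 2) ≤ C)
    {φ : V → ℝ} (hφ : IsCbLip φ) {m : ℝ} (hm : IsGreatest (φ '' Γ) m) :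
    Tendsto (fun n : ℕ => 𝓔.E (fun ω => φ ((n : ℝ)⁻¹ • ∑ i ∈ Finset.range n, Y i ω)))
      atTop (𝓝 m) := by
  obtain ⟨⟨y, hy, rfl⟩, hmax⟩ := hm
  have hcl := hφ.isCLLip
  obtain ⟨-, K, hK⟩ := hφ
  have hlip : ∀ u v, φ u ≤ φ v + K * ‖u - v‖ := fun u v => by
    have := (le_abs_self _).trans (hK.dist_le_mul u v)
    rw [dist_eq_norm] at this
    linarith
  set v : ℕ → ℝ := fun n => ((n : ℝ)⁻¹) ^ 2 *
      ((1 + (n : ℝ)⁻¹) ^ n * ∑ k ∈ Finset.range n, (C + n * ε k ^ 2)) with hv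
  have hv0 : Tendsto v atTop (𝓝 0) := tendsto_inv_sq_mul_pow_mul_sum hε hC0
  have hS : ∀ n, 𝓔.IsRandomVector (fun ω => ∑ i ∈ Finset.range n, Y i ω) := fun n =>
    IsRandomVector.sum hY _
  have hZ : ∀ n : ℕ, (fun ω => φ ((n : ℝ)⁻¹ • ∑ i ∈ Finset.range n, Y i ω)) ∈ 𝓔.H := fun n =>
    (hS n).comp_mem 𝓔 (hcl.comp_clm ((n : ℝ)⁻¹ • ContinuousLinearMap.id ℝ V))
  have hL : ∀ z : V, IsCLLip (fun x => -‖x - z‖ ^ 2) := fun z => by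
    have := ((isCLLip_norm_pow 2).comp_const_add (-z)).neg
    simpa only [neg_add_eq_sub] using this
  have hscale : ∀ {n : ℕ}, 0 < n → ∀ s b : V,
      ‖(n : ℝ)⁻¹ • s - b‖ = (n : ℝ)⁻¹ * ‖s - (n : ℝ) • b‖ := fun {n} hn s b => by
    have hn' : (0 : ℝ) < n := Nat.cast_pos.2 hn
    rw [← Real.norm_of_nonneg (inv_nonneg.2 hn'.le), ← norm_smul, smul_sub,
      Real.norm_of_nonneg (inv_nonneg.2 hn'.le), inv_smul_smul₀ hn'.ne']
  have hbound : ∀ {n : ℕ}, 0 < n → ∀ {δ : ℝ}, 0 < δ →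
      |𝓔.E (fun ω => φ ((n : ℝ)⁻¹ • ∑ i ∈ Finset.range n, Y i ω)) - φ y| ≤
        K * (δ + δ⁻¹ * v n) := by
    intro n hn δ hδ
    have hn' : (0 : ℝ) < n := Nat.cast_pos.2 hn
    have hup := 𝓔.E_infDist_sum_sq_le hY hindep hΓ ⟨y, hy⟩ hΓc hC0 hgle hC hn
    have hlo := 𝓔.le_E_neg_norm_sum_sub_sq hY hindep hC0 (fun i => hleg i y hy)
      (fun i => hC i y hy) hn
    set a : ℝ := K * (δ⁻¹ * ((n : ℝ)⁻¹) ^ 2) with ha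
    have ha0 : 0 ≤ a := by positivity
    have hav : ∀ t : ℝ, K * (δ + δ⁻¹ * (((n : ℝ)⁻¹) ^ 2 * t)) = a * t + K * δ := fun t => by
      rw [ha]; ring
    have hcost : ∀ t : ℝ, K * ((n : ℝ)⁻¹ * t) ≤ a * t ^ 2 + K * δ := fun t => by
      rw [← hav, ← mul_pow]
      exact mul_le_mul_of_nonneg_left (le_add_inv_mul_sq hδ) K.coe_nonneg
    rw [hv, hav, abs_sub_le_iff]
    constructor
    · have hmem := (hS n).comp_mem 𝓔
        (isCLLip_infDist_sq (S := (n : ℝ) • Γ) (Set.Nonempty.smul_set ⟨y, hy⟩))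
      have h1 := 𝓔.mono _ (𝓔.add_const_mem (𝓔.const_mul_mem hmem a) (φ y + K * δ)) _ (hZ n)
        fun ω => by
          obtain ⟨_, ⟨b, hb, rfl⟩, hbd⟩ := (hΓ.smul (n : ℝ)).exists_infDist_eq_dist
            (Set.Nonempty.smul_set ⟨y, hy⟩) (∑ i ∈ Finset.range n, Y i ω)
          have h2 := hlip ((n : ℝ)⁻¹ • ∑ i ∈ Finset.range n, Y i ω) b
          have h3 := hmax ⟨b, hb, rfl⟩
          rw [hscale hn] at h2
          rw [hbd, dist_eq_norm]
          linarith [hcost ‖∑ i ∈ Finset.range n, Y i ω - (n : ℝ) • b‖]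
      rw [𝓔.E_affine hmem ha0] at h1
      linarith [mul_le_mul_of_nonneg_left hup ha0]
    · have hmem := (hS n).comp_mem 𝓔 (hL ((n : ℝ) • y))
      have h1 := 𝓔.mono _ (hZ n) _ (𝓔.add_const_mem (𝓔.const_mul_mem hmem a) (φ y - K * δ))
        fun ω => by
          have h2 := hlip y ((n : ℝ)⁻¹ • ∑ i ∈ Finset.range n, Y i ω)
          rw [norm_sub_rev, hscale hn] at h2
          linarith [hcost ‖∑ i ∈ Finset.range n, Y i ω - (n : ℝ) • y‖]
      rw [𝓔.E_affine hmem ha0] at h1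
      linarith [mul_le_mul_of_nonneg_left hlo ha0]
  refine Metric.tendsto_nhds.2 fun e he => ?_
  have hK1 : (0 : ℝ) < K + 1 := by positivity
  -- Once `v n ≤ δ²`, the bound is at most `2 K δ < e`; `K + 1` covers `K = 0`.
  set δ := e / (2 * (K + 1)) with hδ
  have hδ0 : 0 < δ := by positivity
  filter_upwards [eventually_gt_atTop 0, hv0.eventually_le_const (u := δ ^ 2) (by positivity)]
    with n hn hvn
  rw [Real.dist_eq]
  refine (hbound hn hδ0).trans_lt ?_
  have h1 : δ⁻¹ * v n ≤ δ := by
    rw [inv_mul_le_iff₀ hδ0, ← sq]; exact hvn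
  have h2 : (K + 1) * (δ + δ) = e := by rw [hδ]; field_simp; ring
  nlinarith [mul_le_mul_of_nonneg_left h1 K.coe_nonneg]

end LawOfLargeNumbers

end SublinearExpSpace

/-! ### The maximal distribution and the conclusion -/

theorem IsCLLip.continuous {V : Type*} [NormedAddCommGroup V] {φ : V → ℝ} (h : IsCLLip φ) :
    Continuous φ := by
  obtain ⟨C, -, m, h⟩ := h
  refine continuous_iff_continuousAt.2 fun x => ?_
  refine tendsto_iff_dist_tendsto_zero.2 (squeeze_zero (fun _ => dist_nonneg) (fun y => h y x) ?_)
  have : Continuous fun y : V => C * (1 + ‖y‖ ^ m + ‖x‖ ^ m) * ‖y - x‖ := by fun_prop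
  simpa using this.tendsto x

/-- The space of continuous functions with the functional `X ↦ max_Γ X`. -/
noncomputable def SublinearExpSpace.maximal {V : Type*} [TopologicalSpace V] (Γ : Set V)
    (hΓ : IsCompact Γ) (hΓn : Γ.Nonempty) : SublinearExpSpace V where
  H := { carrier := {X | Continuous X}
         add_mem' := fun hX hY => Continuous.add hX hY
         zero_mem' := continuous_const
         smul_mem' := fun c _ hX => Continuous.const_smul hX c }
  const_mem _ := continuous_const
  abs_mem _ hX := Continuous.abs hX
  comp_mem _ _ hX _ hφ := hφ.continuous.comp (continuous_pi hX)
  E X := sSup (X '' Γ)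
  mono X hX Y _ h := by
    refine csSup_le (hΓn.image _) ?_
    rintro _ ⟨y, hy, rfl⟩
    exact (h y).trans (le_csSup (hΓ.image hX).bddAbove ⟨y, hy, rfl⟩)
  const_preserving c := by rw [hΓn.image_const, csSup_singleton]
  sub_additive X hX Y hY := by
    refine csSup_le (hΓn.image _) ?_
    rintro _ ⟨y, hy, rfl⟩
    exact add_le_add (le_csSup (hΓ.image hX).bddAbove ⟨y, hy, rfl⟩)
      (le_csSup (hΓ.image hY).bddAbove ⟨y, hy, rfl⟩)
  pos_homogeneous X _ c hc := by
    rw [← smul_eq_mul, ← Real.sSup_smul_of_nonneg hc, ← Set.image_smul, Set.image_image]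
    rfl

theorem SublinearExpSpace.isMaximalDistributed_id {d : ℕ} {Γ : Set (EuclideanSpace ℝ (Fin d))}
    (hΓ : IsCompact Γ) (hΓn : Γ.Nonempty) (hΓc : Convex ℝ Γ) :
    (SublinearExpSpace.maximal Γ hΓ hΓn).IsMaximalDistributed id Γ :=
  ⟨fun l => l.continuous, hΓ.isBounded, hΓc, hΓ.isClosed, fun _ hφ =>
    (hΓ.image hφ.isCLLip.continuous).isGreatest_sSup (hΓn.image _)⟩

theorem corollary5p7 {Ω : Type*} (𝓔 : SublinearExpSpace Ω) {d : ℕ}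
    -- the sequence is indexed from `0`: `Y i` is the `(i+1)`-st random vector
    (Y : ℕ → Ω → EuclideanSpace ℝ (Fin d))
    (hY : ∀ i, 𝓔.IsRandomVector (Y i))
    (hindep : ∀ i : ℕ, 𝓔.IndepFrom (Y (i + 1)) (fun ω (j : Fin (i + 1)) => Y j ω))
    (M : ℝ) (hMpos : 0 < M) (hM : ∀ i, 𝓔.E (fun ω => ‖Y i ω‖ ^ 2) ≤ M)
    (Γseq : ℕ → Set (EuclideanSpace ℝ (Fin d)))
    (hΓbdd : ∀ i, Bornology.IsBounded (Γseq i))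
    (hΓconv : ∀ i, Convex ℝ (Γseq i))
    (hΓclosed : ∀ i, IsClosed (Γseq i))
    (hΓrep : ∀ i (p : EuclideanSpace ℝ (Fin d)),
      IsLUB ((fun q => inner ℝ q p) '' Γseq i) (𝓔.E (fun ω => inner ℝ (Y i ω) p)))
    (hΓcauchy : ∀ ε > 0, ∃ N : ℕ, ∀ i ≥ N, ∀ j ≥ N,
      Metric.hausdorffDist (Γseq i) (Γseq j) < ε) :
    ∃ Γ : Set (EuclideanSpace ℝ (Fin d)),
      Γ.Nonempty ∧ Bornology.IsBounded Γ ∧ Convex ℝ Γ ∧ IsClosed Γ ∧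
      Tendsto (fun i => Metric.hausdorffDist Γ (Γseq i)) atTop (𝓝 0) ∧
      ∃ (Ω' : Type) (𝓔' : SublinearExpSpace Ω') (η : Ω' → EuclideanSpace ℝ (Fin d)),
        𝓔'.IsMaximalDistributed η Γ ∧
        𝓔.ConvergesInLaw (fun n ω => (n : ℝ)⁻¹ • ∑ i ∈ Finset.range n, Y i ω) 𝓔' η := by

  have hΓcpt : ∀ i, IsCompact (Γseq i) := fun i =>
    Metric.isCompact_of_isClosed_isBounded (hΓclosed i) (hΓbdd i)
  have hΓne : ∀ i, (Γseq i).Nonempty := fun i => by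
    -- A least upper bound of the empty set would be a least real number.
    rw [Set.nonempty_iff_ne_empty]
    intro h
    have := hΓrep i 0
    rw [h, Set.image_empty, isLUB_empty_iff] at this
    exact not_isBot _ this
  obtain ⟨Γ, hΓ, hΓn, hlim⟩ := exists_isCompact_tendsto_hausdorffDist hΓcpt hΓne hΓcauchy
  have hΓc : Convex ℝ Γ := convex_of_tendsto_hausdorffDist hΓ hΓcpt hΓne hΓconv hlim
  have hmax := SublinearExpSpace.isMaximalDistributed_id hΓ hΓn hΓc
  refine ⟨Γ, hΓn, hΓ.isBounded, hΓc, hΓ.isClosed, hlim, _, _, id, hmax, fun φ hφ => ?_⟩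
  obtain ⟨R, hR⟩ := hΓ.isBounded.exists_norm_le
  -- Here `ε i` is `d_H(Γ, Γ_i)`, and `C` comes from `‖Y - q‖² ≤ 2‖q‖² + 2‖Y‖²`.
  refine 𝓔.tendsto_E_average hY hindep hΓ hΓc hlim (C := 2 * R ^ 2 + 2 * M) (by positivity)
    (fun i p => ?_) (fun i q hq p => ?_) (fun i q hq => ?_) hφ (hmax.2.2.2.2 φ hφ)
  · obtain ⟨q, hq, hqp⟩ := hΓ.exists_isMaxOn hΓn
      (f := fun q => inner ℝ q p) (by fun_prop)
    refine ⟨q, hq, (hΓrep i p).2 ?_⟩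
    rintro _ ⟨r, hr, rfl⟩
    obtain ⟨r', hr', h⟩ := hΓ.exists_inner_le_add_hausdorffDist hΓn (hΓbdd i) hr p
    have : inner ℝ r' p ≤ inner ℝ q p := hqp hr'
    exact h.trans (by linarith)
  · obtain ⟨r, hr, h⟩ :=
      (hΓcpt i).exists_inner_le_add_hausdorffDist (hΓne i) hΓ.isBounded hq p
    have := (hΓrep i p).1 ⟨r, hr, rfl⟩
    rw [Metric.hausdorffDist_comm] at h
    exact h.trans (by linarith)
  · have h1 := 𝓔.E_norm_sub_sq_le (hY i) q
    have h2 := pow_le_pow_left₀ (norm_nonneg q) (hR q hq) 2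
    linarith [hM i]
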